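/- Let $(R,\mathfrak m)$ be a Noetherian local ring, $M$ a finitely generated $R$-module, $d=\dim M$, and $r\ge 0$ an integer. Notation: for an integer $i\ge 0$, the $i$-th pseudo support of $M$ is $$\operatorname{Psupp}^i(M)=\{\mathfrak p\in\operatorname{Spec} R \mid H^{\,i-\dim(R/\mathfrak p)}_{\mathfrak pR_{\mathfrak p}}(M_{\mathfrak p})\neq 0\},$$ where local cohomology in negative degrees is $0$; the $i$-th pseudo dimension is $\operatorname{psd}^i(M)=\max\{\dim(R/\mathfrak p)\mid \mathfrak p\in\operatorname{Psupp}^i(M)\}$, with $\max\emptyset=-\infty$; $M$ satisfies $(S_r)$ if $\operatorname{depth}(M_{\mathfrak p})\ge\min\{r,\dim M_{\mathfrak p}\}$ for all $\mathfrak p\in\operatorname{Supp}(M)$; $\operatorname{nCM}(M)$ is the set of $\mathfrak p\in\operatorname{Spec} R$ such that $M_{\mathfrak p}$ is not Cohen-Macaulay (the zero module counts as Cohen-Macaulay); $M$ is equidimensional if $\dim(R/\mathfrak p)=d$ for every minimal element $\mathfrak p$ of $\operatorname{Ass} M$. Suppose that $M$ is equidimensional and that the ring $R/\operatorname{Ann}_R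 M$ is catenary. Then $M$ satisfies $(S_r)$ if and only if $\operatorname{psd}^i(M)\le i-r$ for all integers $0\le i<d$. In particular, if $M$ satisfies $(S_r)$, then $\dim(R/\mathfrak p)\le d-r-1$ for all $\mathfrak p\in\operatorname{nCM}(M)$. -/

import Mathlib

universe u

open IsLocalRing

namespace PseudoSupport

/-- A commutative ring `A` is catenary: for all primes `p ⊆ q` there is a natural number `n` that
bounds the lengths of all chains of primes from `p` to `q` and is the length of every saturated
chain of primes from `p` to `q`. -/
def IsCatenary (A : Type*) [CommRing A] : Prop :=
  ∀ p q : PrimeSpectrum A, p ≤ q → ∃ n : ℕ,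
    (∀ s : LTSeries (PrimeSpectrum A), s.head = p → s.last = q → s.length ≤ n) ∧
    (∀ s : RelSeries {(a, b) : PrimeSpectrum A × PrimeSpectrum A | a ⋖ b},
      s.head = p → s.last = q → s.length = n)

section Local

variable (A : Type*) [CommRing A] [IsLocalRing A] (N : Type*) [AddCommGroup N] [Module A N]

/-- The depth of a module `N` over a local ring `A`: the supremum of the lengths of the
`N`-regular sequences in the maximal ideal (used only for nonzero finitely generated `N`). -/
noncomputable def depth : ℕ∞ :=
  ⨆ (rs : List A) (_ : ∀ x ∈ rs, x ∈ maximalIdeal A) (_ : RingTheory.Sequence.IsRegular N rs),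
    (rs.length : ℕ∞)

/-- A finitely generated module over a Noetherian local ring is Cohen-Macaulay if it is zero or
its depth equals its dimension. -/
def IsCohenMacaulay : Prop :=
  Subsingleton N ∨ (depth A N : WithBot ℕ∞) = Module.supportDim A N

end Local

section Module

variable (R : Type u) [CommRing R] (M : Type u) [AddCommGroup M] [Module R M]

/-- `M` is equidimensional: `dim (R/p) = dim M` for all minimal elements `p` of `Ass M`. -/
def IsEquidimensional : Prop :=
  ∀ p : Ideal R, Minimal (· ∈ associatedPrimes R M) p →
    ringKrullDim (R ⧸ p) = Module.supportDim R M

/-- The `i`-th pseudo support of `M`: the primes `p` such that the local cohomology module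
`H^{i - dim (R/p)}_{p R_p}(M_p)` is nonzero. Local cohomology in negative degrees is zero, so the
degree is a natural number `j` with `dim (R/p) + j = i`. -/
def psupp (i : ℕ) : Set (PrimeSpectrum R) :=
  {p | ∃ j : ℕ, ringKrullDim (R ⧸ p.asIdeal) + (j : WithBot ℕ∞) = (i : WithBot ℕ∞) ∧
    Nontrivial
      ((localCohomology (maximalIdeal (Localization.AtPrime p.asIdeal)) j).obj
        (ModuleCat.of (Localization.AtPrime p.asIdeal)
          (LocalizedModule.AtPrime p.asIdeal M)))}

/-- The `i`-th pseudo dimension of `M`: the largest `dim (R/p)` for `p` in the `i`-th pseudo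
support, and `⊥ = -∞` if the latter is empty. -/
noncomputable def psd (i : ℕ) : WithBot ℕ∞ :=
  ⨆ p ∈ psupp R M i, ringKrullDim (R ⧸ p.asIdeal)

/-- The non Cohen-Macaulay locus of `M`. -/
def nCM : Set (PrimeSpectrum R) :=
  {p | ¬ IsCohenMacaulay (Localization.AtPrime p.asIdeal) (LocalizedModule.AtPrime p.asIdeal M)}

/-- Serre's condition `(S_r)`: `depth M_p ≥ min {r, dim M_p}` for all `p` in the support of `M`. -/
def SerreCondition (r : ℕ) : Prop :=
  ∀ p ∈ Module.support R M,
    min (r : WithBot ℕ∞)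
        (Module.supportDim (Localization.AtPrime p.asIdeal)
          (LocalizedModule.AtPrime p.asIdeal M)) ≤
      (depth (Localization.AtPrime p.asIdeal) (LocalizedModule.AtPrime p.asIdeal M) :
        WithBot ℕ∞)

end Module

end PseudoSupport

/-! Put d = dim M. Equidimensionality and catenarity give dim R/p + dim M_p = d on Supp M
(`ringKrullDim_quotient_add_supportDim_localizedModule`). Moreover, the local cohomology of a
nonzero M_p vanishes below degree depth M_p and not in that degree. If p ∈ Psupp^i and j = i - dim
R/p, then depth M_p ≤ j, while i < d means j < dim M_p, so (S_r) forces r ≤ j. Conversely, if depth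
M_p < dim M_p, then i = dim R/p + depth M_p is below d and p ∈ Psupp^i, so psd^i ≤ i - r gives r ≤
depth M_p.

The cohomological input comes from the colimit of Ext^j(A/J^t, N) over t. A regular sequence of
length n in J kills every term with j < n (`ext_eq_zero_of_isWeaklyRegular`). For j = n the
transition maps are injective (`ext_precomp_injective`), so the term t = 1, which is nonzero for a
maximal sequence in J = m, embeds into the colimit. -/

namespace PseudoSupport

/-! ### Ext groups and regular sequences -/

section ExtDepth
open CategoryTheory Abelian RingTheory.Sequence Pointwise

variable {A : Type u} [CommRing A]

/-- An element annihilating `X` annihilates all `Ext` groups out of `X`. -/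
lemma ext_smul_eq_zero {X N : ModuleCat.{u} A} {n : ℕ} {a : A}
    (ha : a ∈ Module.annihilator A X) (e : Ext X N n) : a • e = 0 := by
  have h : a • 𝟙 X = 0 := by
    apply ModuleCat.hom_ext
    refine LinearMap.ext fun x ↦ ?_
    exact Module.mem_annihilator.mp ha x
  have h2 : a • e = (Ext.mk₀ (a • 𝟙 X)).comp e (zero_add n) := by
    rw [Ext.mk₀_smul, Ext.smul_comp, Ext.mk₀_id_comp]
  rw [h2, h, Ext.mk₀_zero, Ext.zero_comp]

/-- Multiplication by a regular element `x` on `N` gives a short exact sequence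
`0 → N → N → N / x N → 0`. -/
lemma exists_shortExact_of_isSMulRegular {N : ModuleCat.{u} A} {x : A} (h : IsSMulRegular N x) :
    ∃ (g : N ⟶ ModuleCat.of A (QuotSMulTop x N)) (w : (x • 𝟙 N) ≫ g = 0),
      (ShortComplex.mk (x • 𝟙 N) g w).ShortExact :=
  ⟨_, _, h.smulShortComplex_shortExact⟩

/-- `Ext` groups below the length of a weakly regular sequence vanish. -/
lemma ext_eq_zero_of_isWeaklyRegular {X : ModuleCat.{u} A} (rs : List A)
    (hX : ∀ x ∈ rs, x ∈ (Module.annihilator A X).radical) (N : ModuleCat.{u} A)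
    (hN : IsWeaklyRegular N rs) {i : ℕ} (hi : i < rs.length) (e : Ext X N i) : e = 0 := by
  induction rs generalizing N i with
  | nil => simp at hi
  | cons x rs ih =>
    rw [isWeaklyRegular_cons_iff] at hN
    obtain ⟨g, w, hS⟩ := exists_shortExact_of_isSMulRegular hN.1
    -- The kernel of x on Ext^i(X, N) is the image of Ext^(i-1)(X, N/xN), which vanishes by
    -- induction.
    have inj : ∀ e : Ext X N i, x • e = 0 → e = 0 := by
      intro e he
      rw [Ext.smul_eq_comp_mk₀] at he
      rcases i with _ | i
      · have : Mono (x • 𝟙 N) := hS.mono_f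
        refine Ext.postcomp_mk₀_injective_of_mono X (x • 𝟙 N) ?_
        rw [map_zero]
        exact he
      · obtain ⟨y, rfl⟩ := Ext.covariant_sequence_exact₁ X hS e he rfl
        have hy : y = 0 := ih (fun z hz ↦ hX z (by simp [hz])) _ hN.2 (by simpa using hi) y
        rw [hy, Ext.zero_comp]
    -- A power of x kills X, hence Ext^i(X, N), on which x acts injectively.
    obtain ⟨t, ht⟩ := hX x (by simp)
    have key : ∀ s : ℕ, ∀ e : Ext X N i, x ^ s • e = 0 → e = 0 := by
      intro s
      induction s with
      | zero => intro e he; simpa using he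
      | succ s ihs =>
        intro e he
        refine ihs e (inj _ ?_)
        rwa [smul_smul, ← pow_succ']
    exact key t e (ext_smul_eq_zero ht e)

/-- `Ext` in the degree of the length of a weakly regular sequence does not vanish if there are
nonzero homomorphisms to the quotient by the sequence. -/
lemma nontrivial_ext_of_isWeaklyRegular {X : ModuleCat.{u} A} (rs : List A)
    (hX : ∀ x ∈ rs, x ∈ (Module.annihilator A X).radical) (N : ModuleCat.{u} A)
    (hN : IsWeaklyRegular N rs)
    (h : Nontrivial (X →ₗ[A] N ⧸ (Ideal.ofList rs • ⊤ : Submodule A N))) :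
    Nontrivial (Ext X N rs.length) := by
  induction rs generalizing N with
  | nil =>
    have hb : (Ideal.ofList ([] : List A) • ⊤ : Submodule A N) = ⊥ := by
      rw [Ideal.ofList_nil (R := A), Submodule.bot_smul]
    have e : (N ⧸ (Ideal.ofList ([] : List A) • ⊤ : Submodule A N)) ≃ₗ[A] N :=
      Submodule.quotEquivOfEqBot _ hb
    have : Nontrivial (X →ₗ[A] N) := (e.congrRight (M := X)).symm.toEquiv.nontrivial
    have : Nontrivial (X ⟶ N) := (ModuleCat.homEquiv (M := X) (N := N)).nontrivial
    exact (Ext.homEquiv₀ (X := X) (Y := N)).nontrivial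
  | cons x rs ih =>
    have hN' := hN
    rw [isWeaklyRegular_cons_iff] at hN
    obtain ⟨g, w, hS⟩ := exists_shortExact_of_isSMulRegular hN.1
    have e : (N ⧸ (Ideal.ofList (x :: rs) • ⊤ : Submodule A N)) ≃ₗ[A] QuotSMulTop x N ⧸
        (Ideal.ofList rs • ⊤ : Submodule A (QuotSMulTop x N)) :=
      Submodule.quotOfListConsSMulTopEquivQuotSMulTopInner (R := A) N x rs
    have h2 : Nontrivial (X →ₗ[A] QuotSMulTop x N ⧸
        (Ideal.ofList rs • ⊤ : Submodule A (QuotSMulTop x N))) :=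
      (e.congrRight (M := X)).symm.toEquiv.nontrivial
    have h3 := ih (fun z hz ↦ hX z (by simp [hz])) (ModuleCat.of A (QuotSMulTop x N)) hN.2 h2
    obtain ⟨y, hy⟩ := exists_ne (0 : Ext X (ModuleCat.of A (QuotSMulTop x N)) rs.length)
    -- The connecting map is injective because Ext(X, N) vanishes in degree `rs.length`, one below
    -- the full length.
    refine ⟨⟨y.comp hS.extClass rfl, 0, fun h0 ↦ hy ?_⟩⟩
    obtain ⟨z, rfl⟩ := Ext.covariant_sequence_exact₃ X hS y rfl h0
    have hz : z = 0 := ext_eq_zero_of_isWeaklyRegular (x :: rs) hX N hN' (by simp) z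
    rw [hz, Ext.zero_comp]

/-- Precomposition with an epimorphism is injective on `Ext` in the degree of the length of a
weakly regular sequence whose elements act nilpotently on the kernel. -/
lemma ext_precomp_injective {X X' : ModuleCat.{u} A} (g : X ⟶ X')
    (hg : Function.Surjective g) (rs : List A)
    (hX : ∀ x ∈ rs, x ∈ (Module.annihilator A X).radical) (N : ModuleCat.{u} A)
    (hN : IsWeaklyRegular N rs) (e : Ext X' N rs.length)
    (he : (Ext.mk₀ g).comp e (zero_add _) = 0) : e = 0 := by
  have hepi : Epi g := (ModuleCat.epi_iff_surjective g).mpr hg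
  rcases rs with _ | ⟨x, rs⟩
  · refine Ext.precomp_mk₀_injective_of_epi N g ?_
    rw [map_zero]
    exact he
  · have hS : (LinearMap.shortComplexKer g.hom).ShortExact := LinearMap.shortExact_shortComplexKer hg
    obtain ⟨y, rfl⟩ := Ext.contravariant_sequence_exact₃ hS N e he (n₀ := rs.length)
      (by simp [add_comm])
    have hK : Module.annihilator A X ≤ Module.annihilator A (LinearMap.ker g.hom) :=
      LinearMap.annihilator_le_of_injective (LinearMap.ker g.hom).subtype Subtype.val_injective
    have hy : y = 0 := ext_eq_zero_of_isWeaklyRegular (X := ModuleCat.of A (LinearMap.ker g.hom))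
      (x :: rs) (fun z hz ↦ Ideal.radical_mono hK (hX z hz)) N hN (by simp) y
    rw [hy, Ext.comp_zero]

end ExtDepth

/-! ### Comparison of the two constructions of Ext -/

section OldExt
open CategoryTheory Limits Opposite Abelian

variable {A : Type u} [CommRing A]

lemma extMk_eq_zero_iff_zero {X N : ModuleCat.{u} A} (P : ProjectiveResolution X)
    (f : P.complex.X 0 ⟶ N) (hf : P.complex.d 1 0 ≫ f = 0) :
    P.extMk f 1 rfl hf = 0 ↔ f = 0 := by
  constructor
  · intro h
    simp only [← P.extEquivCohomologyClass.apply_eq_iff_eq,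
      ProjectiveResolution.extEquivCohomologyClass_extMk,
      ProjectiveResolution.extEquivCohomologyClass_zero,
      CochainComplex.HomComplex.CohomologyClass.mk_eq_zero_iff] at h
    rw [CochainComplex.HomComplex.Cocycle.toSingleMk_mem_coboundaries_iff _ _ _ _ _ 1 (by lia)] at h
    obtain ⟨g, hg⟩ := h
    have h0 : IsZero (P.cochainComplex.X 1) :=
      CochainComplex.isZero_of_isStrictlyLE _ 0 _
    rw [h0.eq_of_src g 0, comp_zero] at hg
    rw [← cancel_epi (P.cochainComplexXIso (-(0:ℕ)) 0 rfl).hom, ← hg, comp_zero]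
  · rintro rfl
    simp

lemma extMk_eq_zero_iff_prev {X N : ModuleCat.{u} A} (P : ProjectiveResolution X) (n : ℕ)
    (f : P.complex.X n ⟶ N) (hf : P.complex.d (n + 1) n ≫ f = 0) :
    P.extMk f (n + 1) rfl hf = 0 ↔
      ∃ g : P.complex.X ((ComplexShape.up ℕ).prev n) ⟶ N,
        P.complex.d n ((ComplexShape.up ℕ).prev n) ≫ g = f := by
  rcases n with _ | n
  · rw [extMk_eq_zero_iff_zero P f hf]
    -- Degree 0 has no predecessor, so `prev` returns 0 itself; the differential from 0 to 0 is
    -- zero.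
    have : (ComplexShape.up ℕ).prev 0 = 0 := by simp
    rw [this]
    simp [eq_comm]
  · have : (ComplexShape.up ℕ).prev (n + 1) = n := by simp
    rw [this]
    exact P.extMk_eq_zero_iff f _ rfl hf n rfl

/-- Local cohomology is built from the derived-functor Ext, while the long exact sequences above
concern `Abelian.Ext`. Both are computed by cocycles on a projective resolution. -/
lemma isZero_Ext_iff (X N : ModuleCat.{u} A) (n : ℕ) :
    IsZero (((_root_.Ext A (ModuleCat.{u} A) n).obj (op X)).obj N) ↔
      Subsingleton (Abelian.Ext X N n) := by
  let P := projectiveResolution X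
  rw [(P.isoExt (R := A) n N).isZero_iff, ← HomologicalComplex.exactAt_iff_isZero_homology,
    HomologicalComplex.exactAt_iff' _ ((ComplexShape.up ℕ).prev n) n (n + 1) rfl (by simp),
    ShortComplex.moduleCat_exact_iff]
  constructor
  · intro h
    refine subsingleton_of_forall_eq 0 fun e ↦ ?_
    obtain ⟨f, hf, rfl⟩ := P.extMk_surjective e (n + 1) rfl
    rw [extMk_eq_zero_iff_prev]
    exact h f hf
  · intro h f hf
    exact (extMk_eq_zero_iff_prev P n f hf).mp (Subsingleton.elim _ _)

lemma exists_lift_of_precomp_injective {X X' N : ModuleCat.{u} A} {g : X ⟶ X'} {n : ℕ}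
    (h : ∀ e : Abelian.Ext X' N n, (Abelian.Ext.mk₀ g).comp e (zero_add _) = 0 → e = 0)
    {P : ProjectiveResolution X} {P' : ProjectiveResolution X'}
    (φ : ProjectiveResolution.Hom P P' g) (f : P'.complex.X n ⟶ N)
    (hf : P'.complex.d (n + 1) n ≫ f = 0) (y : P.complex.X ((ComplexShape.up ℕ).prev n) ⟶ N)
    (hy : φ.hom.f n ≫ f = P.complex.d n ((ComplexShape.up ℕ).prev n) ≫ y) :
    ∃ w : P'.complex.X ((ComplexShape.up ℕ).prev n) ⟶ N,
      P'.complex.d n ((ComplexShape.up ℕ).prev n) ≫ w = f := by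
  rw [← extMk_eq_zero_iff_prev P' n f hf]
  apply h
  rw [ProjectiveResolution.mk₀_comp_extMk _ _ _ _ φ, extMk_eq_zero_iff_prev]
  exact ⟨y, hy.symm⟩

/-- Both maps are induced by the same lift of g to projective resolutions; the rest transports
homology through opposite categories. -/
lemma mono_Ext_map {X X' N : ModuleCat.{u} A} (g : X ⟶ X') (n : ℕ)
    (h : ∀ e : Abelian.Ext X' N n, (Abelian.Ext.mk₀ g).comp e (zero_add _) = 0 → e = 0) :
    Mono (((_root_.Ext A (ModuleCat.{u} A) n).map g.op).app N) := by
  let P := projectiveResolution X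
  let P' := projectiveResolution X'
  have e1 : ((_root_.Ext A (ModuleCat.{u} A) n).map g.op).app N =
    ((((linearYoneda A (ModuleCat.{u} A)).obj N).rightOp.leftDerived n).map g).unop := rfl
  rw [e1]
  let φ : ProjectiveResolution.Hom P P' g :=
    ⟨ProjectiveResolution.lift g P P', by
      simpa using ProjectiveResolution.lift_commutes_zero g P P'⟩
  rw [Functor.leftDerived_map_eq (P := P) (Q := P') _ n g φ.hom φ.hom_comp_π]
  rw [unop_comp, unop_comp]
  let F := ((linearYoneda A (ModuleCat.{u} A)).obj N).rightOp
  let ψ := (F.mapHomologicalComplex (ComplexShape.down ℕ)).map φ.hom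
  let χ : P'.complex.linearYonedaObj A N ⟶ P.complex.linearYonedaObj A N :=
    ((HomologicalComplex.unopFunctor _ _).map ψ.op)
  have hχ : Mono (HomologicalComplex.homologyMap χ n) := by
    rw [HomologicalComplex.mono_homologyMap_iff_up_to_refinements _
      ((ComplexShape.up ℕ).prev n) n (n + 1) rfl (by simp)]
    intro Z x hx y hy
    have key : ∀ z : Z, ∃ w, x.hom z =
        ((P'.complex.linearYonedaObj A N).d ((ComplexShape.up ℕ).prev n) n).hom w := by
      intro z
      obtain ⟨w, hw⟩ := exists_lift_of_precomp_injective h φ (x.hom z) congr($(hx).hom z) (y.hom z)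
        congr($(hy).hom z)
      exact ⟨w, hw.symm⟩
    -- Bounding cochains exist pointwise but need not depend linearly on z; the pullback W is the
    -- refinement of Z on which they do.
    let W : Submodule A (Z × (P'.complex.linearYonedaObj A N).X ((ComplexShape.up ℕ).prev n)) :=
      LinearMap.eqLocus (x.hom ∘ₗ LinearMap.fst A _ _)
        (((P'.complex.linearYonedaObj A N).d ((ComplexShape.up ℕ).prev n) n).hom ∘ₗ
          LinearMap.snd A _ _)
    refine ⟨ModuleCat.of A W, ModuleCat.ofHom (LinearMap.fst A _ _ ∘ₗ W.subtype), ?_,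
      ModuleCat.ofHom (LinearMap.snd A _ _ ∘ₗ W.subtype), ?_⟩
    · rw [ModuleCat.epi_iff_surjective]
      intro z
      obtain ⟨w, hw⟩ := key z
      exact ⟨⟨(z, w), hw⟩, rfl⟩
    · apply ModuleCat.hom_ext
      refine LinearMap.ext fun w ↦ ?_
      exact w.2
  have hψ : Mono (HomologicalComplex.homologyMap ψ n).unop := by
    have nat := HomologicalComplex.homologyOp_hom_naturality χ n
    have h2 : Epi ((HomologicalComplex.homologyMap χ n).op) := inferInstance
    have h3 : Epi (HomologicalComplex.homologyMap
        ((HomologicalComplex.opFunctor _ _).map χ.op) n) := by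
      have nat' := (Iso.eq_comp_inv _).mpr nat
      rw [nat']
      exact @epi_comp _ _ _ _ _ _ (@epi_comp _ _ _ _ _ _
        (@IsIso.epi_of_iso _ _ _ _ _ (Iso.isIso_hom _)) _ h2) _
        (@IsIso.epi_of_iso _ _ _ _ _ (Iso.isIso_inv _))
    have h4 : Epi (HomologicalComplex.homologyMap ψ n) := h3
    exact unop_mono_of_epi _
  have h5 : Mono (P'.isoLeftDerivedObj ((linearYoneda A (ModuleCat.{u} A)).obj N).rightOp n).inv.unop :=
    unop_mono_of_epi _
  have h6 : Mono (P.isoLeftDerivedObj ((linearYoneda A (ModuleCat.{u} A)).obj N).rightOp n).hom.unop :=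
    unop_mono_of_epi _
  exact @mono_comp _ _ _ _ _ _ (@mono_comp _ _ _ _ _ _ h5 _ hψ) _ h6

end OldExt

/-! ### Vanishing and nonvanishing of local cohomology -/

section LocalCohomology
open CategoryTheory Limits Opposite RingTheory.Sequence

variable {A : Type u} [CommRing A]

lemma mem_radical_annihilator_quotient_pow {J : Ideal A} {x : A} (hx : x ∈ J) (t : ℕ) :
    x ∈ (Module.annihilator A (A ⧸ J ^ t)).radical := by
  rw [Ideal.annihilator_quotient]
  exact ⟨t, Ideal.pow_mem_pow hx t⟩

/-- Local cohomology as a colimit of modules. -/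
noncomputable def localCohomologyObjIso (J : Ideal A) (j : ℕ) (N : ModuleCat.{u} A) :
    (localCohomology J j).obj N ≅
      colimit (localCohomology.diagram (localCohomology.idealPowersDiagram J) j ⋙
        (evaluation _ _).obj N) :=
  colimitObjIsoColimitCompEvaluation _ _

lemma subsingleton_localCohomology (J : Ideal A) (N : ModuleCat.{u} A) (rs : List A)
    (hrs : ∀ x ∈ rs, x ∈ J) (hN : IsWeaklyRegular N rs) {j : ℕ} (hj : j < rs.length) :
    Subsingleton ((localCohomology J j).obj N) := by
  rw [← ModuleCat.isZero_iff_subsingleton, (localCohomologyObjIso J j N).isZero_iff,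
    IsZero.iff_id_eq_zero]
  refine colimit.hom_ext fun t ↦ IsZero.eq_of_src ?_ _ _
  refine (isZero_Ext_iff (ModuleCat.of A (A ⧸ J ^ t.unop.unop)) N j).mpr ?_
  refine subsingleton_of_forall_eq 0 fun e ↦ ext_eq_zero_of_isWeaklyRegular rs ?_ N hN hj e
  exact fun x hx ↦ mem_radical_annihilator_quotient_pow (hrs x hx) _

lemma nontrivial_localCohomology (J : Ideal A) (N : ModuleCat.{u} A) (rs : List A)
    (hrs : ∀ x ∈ rs, x ∈ J) (hN : IsWeaklyRegular N rs)
    (h : Nontrivial (A ⧸ J →ₗ[A] N ⧸ (Ideal.ofList rs • ⊤ : Submodule A N))) :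
    Nontrivial ((localCohomology J rs.length).obj N) := by
  let G := localCohomology.diagram (localCohomology.idealPowersDiagram J) rs.length ⋙
        (evaluation _ _).obj N
  have hmono : ∀ {s t : (ℕᵒᵖ)ᵒᵖ} (f : s ⟶ t), Mono (G.map f) := by
    intro s t f
    refine mono_Ext_map
      ((localCohomology.ringModIdeals (localCohomology.idealPowersDiagram J)).map f.unop) _
      fun e he ↦ ext_precomp_injective _ ?_ rs ?_ N hN e he
    · intro y
      obtain ⟨y, rfl⟩ := Submodule.Quotient.mk_surjective _ y
      exact ⟨Submodule.Quotient.mk y, rfl⟩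
    · exact fun x hx ↦ mem_radical_annihilator_quotient_pow (hrs x hx) _
  rw [← not_subsingleton_iff_nontrivial, ← ModuleCat.isZero_iff_subsingleton,
    (localCohomologyObjIso J _ N).isZero_iff]
  intro h0
  -- In a filtered colimit, elements with equal images already agree at a later stage, and the
  -- transition maps are injective.
  have hι : Mono (colimit.ι G (op (op 1))) := by
    rw [ModuleCat.mono_iff_injective]
    intro x y hxy
    have : PreservesFilteredColimitsOfSize.{0, 0} (forget (ModuleCat.{u} A)) :=
      preservesFilteredColimitsOfSize_shrink.{0, u, 0, u} _
    obtain ⟨k, f, g, hfg⟩ := Concrete.colimit_exists_of_rep_eq.{u} G x y hxy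
    obtain rfl : f = g := Subsingleton.elim _ _
    exact (ModuleCat.mono_iff_injective _).mp (hmono f) hfg
  have h1 : IsZero (G.obj (op (op 1))) := IsZero.of_mono (colimit.ι G (op (op 1))) h0
  have h2 := (isZero_Ext_iff (ModuleCat.of A (A ⧸ J ^ 1)) N rs.length).mp h1
  rw [← not_nontrivial_iff_subsingleton] at h2
  refine h2 (nontrivial_ext_of_isWeaklyRegular rs ?_ N hN ?_)
  · exact fun x hx ↦ mem_radical_annihilator_quotient_pow (hrs x hx) _
  · change Nontrivial (A ⧸ J ^ 1 →ₗ[A] _)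
    rwa [pow_one]

end LocalCohomology

/-! ### Depth and maximal regular sequences -/

section Depth
open RingTheory.Sequence

variable (A : Type u) [CommRing A] [IsLocalRing A] [IsNoetherianRing A]
  (N : Type u) [AddCommGroup N] [Module A N] [Module.Finite A N]

omit [Module.Finite A N] in
lemma exists_supportDim_eq_nat [Nontrivial N] : ∃ n : ℕ, Module.supportDim A N = n := by
  have h1 : Module.supportDim A N ≠ ⊥ := Module.supportDim_ne_bot_of_nontrivial A N
  have h2 : Module.supportDim A N ≠ ⊤ := fun h ↦ by
    have := Module.supportDim_le_ringKrullDim A N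
    rw [h, top_le_iff] at this
    exact ringKrullDim_ne_top this
  generalize Module.supportDim A N = x at h1 h2
  induction x using WithBot.recBotCoe with
  | bot => exact absurd rfl h1
  | coe x =>
    induction x using ENat.recTopCoe with
    | top => exact absurd rfl h2
    | coe n => exact ⟨n, rfl⟩

variable {A N}

lemma length_le_supportDim {rs : List A} (h : IsRegular N rs) :
    (rs.length : WithBot ℕ∞) ≤ Module.supportDim A N := by
  rw [← Module.supportDim_add_length_eq_supportDim_of_isRegular rs h]
  have : Nontrivial (N ⧸ (Ideal.ofList rs • ⊤ : Submodule A N)) := h.quot_ofList_smul_nontrivial ⊤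
  obtain ⟨n, hn⟩ := exists_supportDim_eq_nat A (N ⧸ (Ideal.ofList rs • ⊤ : Submodule A N))
  rw [hn]
  norm_cast
  omega

variable (A N)

lemma exists_isRegular_length_eq_depth [Nontrivial N] :
    ∃ rs : List A, (∀ x ∈ rs, x ∈ maximalIdeal A) ∧ IsRegular N rs ∧
      depth A N = rs.length ∧ (rs.length : WithBot ℕ∞) ≤ Module.supportDim A N ∧
      Nontrivial (ResidueField A →ₗ[A] N ⧸ (Ideal.ofList rs • ⊤ : Submodule A N)) := by
  obtain ⟨d, hd⟩ := exists_supportDim_eq_nat A N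
  let P : ℕ → Prop := fun n ↦ ∃ rs : List A, (∀ x ∈ rs, x ∈ maximalIdeal A) ∧ IsRegular N rs ∧
    rs.length = n
  have hle : ∀ n, P n → n ≤ d := by
    rintro n ⟨rs, h1, h2, rfl⟩
    have := length_le_supportDim h2
    rw [hd] at this
    exact_mod_cast this
  have h0 : P 0 := ⟨[], by simp, IsRegular.nil A N, rfl⟩
  classical
  obtain ⟨rs, h1, h2, h3⟩ : P (Nat.findGreatest P d) := Nat.findGreatest_spec (Nat.zero_le d) h0
  have hmax : ∀ rs' : List A, (∀ x ∈ rs', x ∈ maximalIdeal A) → IsRegular N rs' →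
      rs'.length ≤ rs.length := fun rs' a b ↦
    h3 ▸ Nat.le_findGreatest (hle _ ⟨rs', a, b, rfl⟩) ⟨rs', a, b, rfl⟩
  refine ⟨rs, h1, h2, le_antisymm ?_ ?_, length_le_supportDim h2, ?_⟩
  · refine iSup_le fun rs' ↦ iSup_le fun a ↦ iSup_le fun b ↦ ?_
    exact_mod_cast hmax rs' a b
  · exact le_iSup_of_le rs (le_iSup_of_le h1 (le_iSup_of_le h2 le_rfl))
  -- If no nonzero map from the residue field exists, some r in the maximal ideal is regular on the
  -- quotient, and appending r contradicts maximality.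
  · by_contra hn
    rw [not_nontrivial_iff_subsingleton, IsSMulRegular.subsingleton_linearMap_iff] at hn
    obtain ⟨r, hr, hreg⟩ := hn
    have hr' : r ∈ maximalIdeal A := by
      have : Module.annihilator A (ResidueField A) = maximalIdeal A := Ideal.annihilator_quotient
      rwa [this] at hr
    have h4 : ∀ x ∈ rs ++ [r], x ∈ maximalIdeal A := by
      simp only [List.mem_append, List.mem_singleton]
      rintro x (hx | rfl)
      exacts [h1 x hx, hr']
    have h5 : IsRegular N (rs ++ [r]) := by
      refine IsRegular.of_isWeaklyRegular_of_mem_maximalIdeal N h4 ?_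
      rw [isWeaklyRegular_append_iff, isWeaklyRegular_singleton_iff]
      exact ⟨h2.1, hreg⟩
    have := hmax _ h4 h5
    simp at this

end Depth

/-! ### The dimension formula -/

section Dimension
open Order

lemma exists_relSeries_covBy_of_le {α : Type*} [PartialOrder α] [WellFoundedLT α]
    [WellFoundedGT α] {a b : α} (h : a ≤ b) :
    ∃ t : RelSeries {(a, b) : α × α | a ⋖ b}, t.head = a ∧ t.last = b := by
  obtain ⟨t, h₁, m, h₂, ht⟩ := exists_covBy_seq_of_wellFoundedLT_wellFoundedGT_of_le h
  exact ⟨⟨m, (t ·), fun i ↦ by simpa using! ht i⟩, h₁, h₂⟩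

/-- In a catenary order with a greatest element all of whose minimal elements have the same
coheight, the height and the coheight of every element add up to the dimension. -/
lemma height_add_coheight_eq_krullDim {α : Type*} [PartialOrder α] [OrderTop α]
    [FiniteDimensionalOrder α]
    (hcat : ∀ p q : α, p ≤ q → ∃ n : ℕ,
      (∀ s : LTSeries α, s.head = p → s.last = q → s.length ≤ n) ∧
      (∀ s : RelSeries {(a, b) : α × α | a ⋖ b}, s.head = p → s.last = q → s.length = n))
    (hmin : ∀ q : α, IsMin q → (coheight q : WithBot ℕ∞) = krullDim α) (p : α) :
    ((height p + coheight p : ℕ∞) : WithBot ℕ∞) = krullDim α := by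
  have : Nonempty α := ⟨⊤⟩
  have : WellFoundedLT α := ⟨(SetRel.IsWellFounded.of_finiteDimensional {(a, b) : α × α | a < b})⟩
  have : WellFoundedGT α := ⟨(SetRel.IsWellFounded.inv_of_finiteDimensional {(a, b) : α × α | a < b})⟩
  refine le_antisymm ?_ ?_
  · rw [krullDim_eq_iSup_height_add_coheight_of_nonempty, WithBot.coe_le_coe]
    exact le_iSup (fun a : α ↦ height a + coheight a) p
  · obtain ⟨q, hqp, hq⟩ := exists_minimal_le_of_wellFoundedLT (fun _ : α ↦ True) p trivial
    rw [minimal_true] at hq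
    obtain ⟨n, hn, hsat⟩ := hcat q ⊤ le_top
    rw [← hmin q hq, WithBot.coe_le_coe]
    obtain ⟨t₁, h₁, h₁'⟩ := exists_relSeries_covBy_of_le hqp
    obtain ⟨t₂, h₂, h₂'⟩ := exists_relSeries_covBy_of_le (le_top : p ≤ ⊤)
    have hlen : t₁.length + t₂.length = n :=
      hsat (t₁.smash t₂ (h₁'.trans h₂.symm)) (by simp [h₁]) (by simp [h₂'])
    -- The catenary bound covers only chains ending at ⊤; other chains are first extended by ⊤.
    have hq' : coheight q ≤ n := by
      refine coheight_le fun s hs ↦ ?_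
      by_cases hl : s.last = ⊤
      · exact_mod_cast hn s hs hl
      · have := hn (s.snoc ⊤ (lt_top_iff_ne_top.mpr hl)) (by simp [hs]) (by simp)
        rw [RelSeries.snoc_length] at this
        exact_mod_cast (Nat.le_succ _).trans this
    refine hq'.trans ?_
    rw [← hlen, Nat.cast_add]
    let f : ∀ t : RelSeries {(a, b) : α × α | a ⋖ b}, LTSeries α := fun t ↦
      ⟨t.length, t.toFun, fun i ↦ (t.step i).lt⟩
    refine add_le_add ?_ ?_
    · rw [← h₁']
      exact length_le_height_last (p := f t₁)
    · rw [← h₂]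
      exact length_le_coheight_head (p := f t₂)

variable (R : Type u) [CommRing R] (M : Type u) [AddCommGroup M] [Module R M]

/-- A prime of the localization at `p` lies in the support of `M_p` iff its preimage lies in the
support of `M`. -/
lemma mem_support_localizedModule_iff (p : Ideal R) [p.IsPrime]
    (q : PrimeSpectrum (Localization.AtPrime p)) :
    q ∈ Module.support (Localization.AtPrime p) (LocalizedModule.AtPrime p M) ↔
      PrimeSpectrum.comap (algebraMap R (Localization.AtPrime p)) q ∈ Module.support R M := by
  have hunit : ∀ s : p.primeCompl, algebraMap R (Localization.AtPrime p) s ∉ q.asIdeal :=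
    fun s hs ↦ q.2.ne_top (Ideal.eq_top_of_isUnit_mem _ hs (IsLocalization.map_units _ s))
  rw [Module.mem_support_iff', Module.mem_support_iff']
  constructor
  · rintro ⟨x, hx⟩
    induction x using LocalizedModule.induction_on with | h m s =>
    refine ⟨m, fun r hr h0 ↦ hx (algebraMap R _ r) hr ?_⟩
    rw [algebraMap_smul, LocalizedModule.smul'_mk, h0, LocalizedModule.zero_mk]
  · rintro ⟨m, hm⟩
    refine ⟨LocalizedModule.mk m 1, fun r hr h0 ↦ ?_⟩
    obtain ⟨a, s, rfl⟩ := IsLocalization.exists_mk'_eq p.primeCompl r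
    have h1 : algebraMap R (Localization.AtPrime p) a • LocalizedModule.mk m (1 : p.primeCompl) = 0 := by
      rw [← IsLocalization.mk'_spec (Localization.AtPrime p) a s, mul_comm, mul_smul, h0, smul_zero]
    rw [algebraMap_smul, LocalizedModule.smul'_mk, ← LocalizedModule.zero_mk 1,
      LocalizedModule.mk_eq] at h1
    obtain ⟨u, hu⟩ := h1
    refine hm (u * a) (fun hmem ↦ ?_) (by simpa [mul_smul, Submonoid.smul_def] using hu)
    change algebraMap R _ (u * a) ∈ q.asIdeal at hmem
    rw [map_mul] at hmem
    refine hr ?_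
    rw [← IsLocalization.mk'_spec (Localization.AtPrime p) a s] at hmem
    rcases q.2.mem_or_mem hmem with h | h
    · exact absurd h (hunit u)
    · exact (q.2.mem_or_mem h).resolve_right (hunit s)

/-- The dimension of the localization `M_p` is the height of `p` in the support of `M`. -/
lemma supportDim_localizedModule (p : Module.support R M) :
    Module.supportDim (Localization.AtPrime p.1.asIdeal)
      (LocalizedModule.AtPrime p.1.asIdeal M) = height p := by
  rw [Module.supportDim, Order.height_eq_krullDim_Iic]
  let e := IsLocalization.AtPrime.primeSpectrumOrderIso (Localization.AtPrime p.1.asIdeal) p.1.asIdeal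
  refine le_antisymm ?_ ?_
  · refine krullDim_le_of_strictMono
      (fun q ↦ ⟨⟨(e q.1).1, (mem_support_localizedModule_iff R M _ _).mp q.2⟩, (e q.1).2⟩) ?_
    intro q q' h
    exact e.strictMono h
  · refine krullDim_le_of_strictMono
      (fun q ↦ ⟨e.symm ⟨q.1.1, q.2⟩, (mem_support_localizedModule_iff R M _ _).mpr ?_⟩) ?_
    · have h : (e (e.symm ⟨q.1.1, q.2⟩)).1 = q.1.1 := by rw [e.apply_symm_apply]
      have := q.1.2
      rwa [← h] at this
    · intro q q' h
      exact e.symm.strictMono h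

lemma ringKrullDim_quotient_eq_coheight (p : Module.support R M) :
    ringKrullDim (R ⧸ p.1.asIdeal) = coheight p := by
  rw [ringKrullDim_quotient, Order.coheight_eq_krullDim_Ici]
  refine le_antisymm ?_ ?_
  · refine krullDim_le_of_strictMono
      (fun q ↦ ⟨⟨q.1, Module.mem_support_mono (p := p.1) q.2 p.2⟩, q.2⟩) ?_
    intro q q' h
    exact h
  · refine krullDim_le_of_strictMono (fun q ↦ ⟨q.1.1, q.2⟩) ?_
    intro q q' h
    exact h

variable {R M}

/-- The dimension formula for equidimensional modules with catenary support. -/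
lemma ringKrullDim_quotient_add_supportDim_localizedModule [IsNoetherianRing R] [IsLocalRing R]
    [Module.Finite R M] (hM : IsEquidimensional R M)
    (hcat : IsCatenary (R ⧸ Module.annihilator R M)) (p : PrimeSpectrum R)
    (hp : p ∈ Module.support R M) :
    ringKrullDim (R ⧸ p.asIdeal) + Module.supportDim (Localization.AtPrime p.asIdeal)
      (LocalizedModule.AtPrime p.asIdeal M) = Module.supportDim R M := by
  let e : PrimeSpectrum (R ⧸ Module.annihilator R M) ≃o Module.support R M :=
    (Ideal.primeSpectrumQuotientOrderIsoZeroLocus (Module.annihilator R M)).trans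
      (OrderIso.setCongr _ _ Module.support_eq_zeroLocus.symm)
  have hA : Nontrivial (R ⧸ Module.annihilator R M) := by
    refine Ideal.Quotient.nontrivial_iff.mpr fun h ↦ ?_
    have := Module.annihilator_le_of_mem_support hp
    rw [h, top_le_iff] at this
    exact p.2.ne_top this
  have hloc : IsLocalRing (R ⧸ Module.annihilator R M) :=
    IsLocalRing.of_surjective' (Ideal.Quotient.mk _) Ideal.Quotient.mk_surjective
  have key := height_add_coheight_eq_krullDim hcat ?_ (e.symm ⟨p, hp⟩)
  · rw [ringKrullDim_quotient_eq_coheight R M ⟨p, hp⟩, supportDim_localizedModule R M ⟨p, hp⟩,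
      Module.supportDim, ← krullDim_eq_of_orderIso e, ← key, height_orderIso, coheight_orderIso,
      add_comm, WithBot.coe_add]
  · intro q hq
    have hq' : IsMin (e q) := by
      intro x hx
      have := hq (b := e.symm x) (by rwa [e.symm_apply_le])
      rwa [e.le_symm_apply] at this
    rw [← coheight_orderIso e, ← ringKrullDim_quotient_eq_coheight, krullDim_eq_of_orderIso e]
    -- Minimal primes of the annihilator are associated, and associated primes contain the
    -- annihilator, so minimality in the support gives minimality in Ass M.
    refine hM (e q).1.asIdeal ⟨?_, ?_⟩
    · refine Module.associatedPrimes.minimalPrimes_annihilator_subset_associatedPrimes R M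
        ⟨⟨(e q).1.2, Module.annihilator_le_of_mem_support (e q).2⟩, ?_⟩
      · rintro I ⟨hI, hle⟩ hIq
        exact hq' (b := ⟨⟨I, hI⟩, Module.mem_support_iff_of_finite.mpr hle⟩) hIq
    · intro I hI hIq
      have hIann : Module.annihilator R M ≤ I :=
        Submodule.annihilator_top.symm.trans_le (IsAssociatedPrime.annihilator_le hI)
      exact hq' (b := ⟨⟨I, hI.isPrime⟩, Module.mem_support_iff_of_finite.mpr hIann⟩) hIq

end Dimension

/-! ### Depth via local cohomology -/

section LocalCohomologyDepth
open RingTheory.Sequence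

variable {A : Type u} [CommRing A] [IsLocalRing A] {N : Type u} [AddCommGroup N] [Module A N]

lemma nontrivial_of_nontrivial_localCohomology {j : ℕ}
    (h : Nontrivial ((localCohomology (maximalIdeal A) j).obj (ModuleCat.of A N))) :
    Nontrivial N := by
  by_contra hN
  rw [not_nontrivial_iff_subsingleton] at hN
  -- On the zero module even a sequence of zeros is weakly regular, here of length j + 1 > j.
  refine not_subsingleton_iff_nontrivial.mpr h
    (subsingleton_localCohomology (maximalIdeal A) (ModuleCat.of A N) (List.replicate (j + 1) 0)
      ?_ ?_ (by simp))
  · intro x hx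
    rw [(List.mem_replicate.mp hx).2]
    exact zero_mem _
  · refine ⟨fun i hi ↦ ?_⟩
    exact fun a b _ ↦ Subsingleton.elim _ _

lemma depth_le_of_nontrivial_localCohomology {j : ℕ}
    (h : Nontrivial ((localCohomology (maximalIdeal A) j).obj (ModuleCat.of A N))) :
    depth A N ≤ j := by
  refine iSup_le fun rs ↦ iSup_le fun hrs ↦ iSup_le fun hN ↦ ?_
  by_contra hlt
  rw [not_le] at hlt
  exact not_subsingleton_iff_nontrivial.mpr h
    (subsingleton_localCohomology (maximalIdeal A) (ModuleCat.of A N) rs hrs hN.1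
      (by exact_mod_cast hlt))

lemma exists_depth_eq_and_nontrivial_localCohomology [IsNoetherianRing A] [Module.Finite A N]
    [Nontrivial N] :
    ∃ c : ℕ, depth A N = c ∧ (c : WithBot ℕ∞) ≤ Module.supportDim A N ∧
      Nontrivial ((localCohomology (maximalIdeal A) c).obj (ModuleCat.of A N)) := by
  obtain ⟨rs, h1, h2, h3, h4, h5⟩ := exists_isRegular_length_eq_depth A N
  exact ⟨rs.length, h3, h4,
    nontrivial_localCohomology (maximalIdeal A) (ModuleCat.of A N) rs h1 h2.1 h5⟩

end LocalCohomologyDepth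

/-! ### Serre's condition and pseudo dimension -/

section Main

variable {R : Type u} [CommRing R] [IsNoetherianRing R] [IsLocalRing R]
  {M : Type u} [AddCommGroup M] [Module R M] [Module.Finite R M]

lemma exists_nat_dimensions (hM : IsEquidimensional R M)
    (hcat : IsCatenary (R ⧸ Module.annihilator R M)) {p : PrimeSpectrum R}
    (hp : Nontrivial (LocalizedModule.AtPrime p.asIdeal M)) :
    ∃ a b : ℕ, ringKrullDim (R ⧸ p.asIdeal) = a ∧
      Module.supportDim (Localization.AtPrime p.asIdeal)
        (LocalizedModule.AtPrime p.asIdeal M) = b ∧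
      Module.supportDim R M = (a + b : ℕ) := by
  have hp' : p ∈ Module.support R M := hp
  have h := ringKrullDim_quotient_add_supportDim_localizedModule hM hcat p hp'
  obtain ⟨b, hb⟩ := exists_supportDim_eq_nat (Localization.AtPrime p.asIdeal)
    (LocalizedModule.AtPrime p.asIdeal M)
  obtain ⟨a, ha⟩ := exists_supportDim_eq_nat R (R ⧸ p.asIdeal)
  rw [Module.supportDim_quotient_eq_ringKrullDim] at ha
  refine ⟨a, b, ha, hb, ?_⟩
  rw [← h, ha, hb]
  norm_cast

-- Any member of the pseudo support yields r ≤ i, so i - r makes sense in ℕ and bounds the supremum;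
-- with no member the left side is ⊥.
omit [Module.Finite R M] in
lemma psd_add_le_iff {r i : ℕ} :
    psd R M i + (r : WithBot ℕ∞) ≤ (i : WithBot ℕ∞) ↔
      ∀ p ∈ psupp R M i, ringKrullDim (R ⧸ p.asIdeal) + (r : WithBot ℕ∞) ≤ (i : WithBot ℕ∞) := by
  constructor
  · intro h p hp
    refine le_trans ?_ h
    gcongr
    exact le_iSup₂_of_le p hp le_rfl
  · intro h
    rcases (psupp R M i).eq_empty_or_nonempty with h0 | ⟨p, hp⟩
    · simp [psd, h0]
    · have key : ∀ q ∈ psupp R M i, r ≤ i ∧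
          ringKrullDim (R ⧸ q.asIdeal) ≤ ((i - r : ℕ) : WithBot ℕ∞) := by
        intro q hq
        obtain ⟨a, ha⟩ := exists_supportDim_eq_nat R (R ⧸ q.asIdeal)
        rw [Module.supportDim_quotient_eq_ringKrullDim] at ha
        have h1 := h q hq
        rw [ha] at h1 ⊢
        norm_cast at h1 ⊢
        omega
      have hle : psd R M i ≤ ((i - r : ℕ) : WithBot ℕ∞) := iSup₂_le fun q hq ↦ (key q hq).2
      calc psd R M i + (r : WithBot ℕ∞) ≤ ((i - r : ℕ) : WithBot ℕ∞) + (r : WithBot ℕ∞) := by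
            gcongr
        _ = (i : WithBot ℕ∞) := by
            norm_cast
            rw [Nat.sub_add_cancel (key p hp).1]

lemma serreCondition_iff_psd_le (hM : IsEquidimensional R M)
    (hcat : IsCatenary (R ⧸ Module.annihilator R M)) (r : ℕ) :
    SerreCondition R M r ↔ ∀ i : ℕ, (i : WithBot ℕ∞) < Module.supportDim R M →
        psd R M i + (r : WithBot ℕ∞) ≤ (i : WithBot ℕ∞) := by
  constructor
  · intro hS i hi
    rw [psd_add_le_iff]
    rintro p ⟨j, hj, hH⟩
    have hp := nontrivial_of_nontrivial_localCohomology hH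
    obtain ⟨a, b, ha, hb, hab⟩ := exists_nat_dimensions hM hcat hp
    have h1 := (hS p hp).trans (WithBot.coe_le_coe.mpr (depth_le_of_nontrivial_localCohomology hH))
    rw [hb] at h1
    rw [hab] at hi
    rw [ha] at hj ⊢
    have h2 : min r b ≤ j := by
      change min (r : WithBot ℕ∞) (b : WithBot ℕ∞) ≤ (j : WithBot ℕ∞) at h1
      rw [min_le_iff] at h1 ⊢
      exact_mod_cast h1
    norm_cast at hi hj ⊢
    omega
  · intro h p hp
    have hp' : Nontrivial (LocalizedModule.AtPrime p.asIdeal M) := hp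
    obtain ⟨a, b, ha, hb, hab⟩ := exists_nat_dimensions hM hcat hp'
    obtain ⟨c, hc, hcb, hH⟩ := exists_depth_eq_and_nontrivial_localCohomology
      (A := Localization.AtPrime p.asIdeal) (N := LocalizedModule.AtPrime p.asIdeal M)
    rw [hb] at hcb
    -- With c = depth M_p, this is the index i for which the local cohomology degree at p is exactly
    -- the depth.
    have h1 := h (a + c)
    rw [hab, psd_add_le_iff] at h1
    rw [hb, hc]
    change min (r : WithBot ℕ∞) (b : WithBot ℕ∞) ≤ (c : WithBot ℕ∞)
    by_cases hlt : c < b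
    · have h2 := h1 (by norm_cast; omega) p ⟨c, by rw [ha]; norm_cast, hH⟩
      rw [ha] at h2
      norm_cast at h2
      exact min_le_of_left_le (by norm_cast; omega)
    · exact min_le_of_right_le (by norm_cast; omega)

/-- Off the Cohen-Macaulay locus depth M_p < dim M_p, so (S_r) gives r ≤ depth M_p, hence r + 1 ≤
dim M_p, and the dimension formula concludes. -/
lemma ringKrullDim_add_le_of_mem_nCM (hM : IsEquidimensional R M)
    (hcat : IsCatenary (R ⧸ Module.annihilator R M)) {r : ℕ} (hS : SerreCondition R M r)
    {p : PrimeSpectrum R} (hp : p ∈ nCM R M) :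
    ringKrullDim (R ⧸ p.asIdeal) + (r : WithBot ℕ∞) + 1 ≤ Module.supportDim R M := by
  obtain ⟨h0, hne⟩ := not_or.mp hp
  have hp' := not_subsingleton_iff_nontrivial.mp h0
  obtain ⟨a, b, ha, hb, hab⟩ := exists_nat_dimensions hM hcat hp'
  obtain ⟨c, hc, hcb, -⟩ := exists_depth_eq_and_nontrivial_localCohomology
    (A := Localization.AtPrime p.asIdeal) (N := LocalizedModule.AtPrime p.asIdeal M)
  have h1 := hS p hp'
  rw [hb, hc] at h1 hne
  rw [hb] at hcb
  rw [ha, hab]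
  have h2 : min r b ≤ c := by
    change min (r : WithBot ℕ∞) (b : WithBot ℕ∞) ≤ (c : WithBot ℕ∞) at h1
    rw [min_le_iff] at h1 ⊢
    exact_mod_cast h1
  have h3 : c ≠ b := fun h ↦ hne (by rw [h]; rfl)
  norm_cast at hcb ⊢
  omega

end Main

end PseudoSupport

/-- The inequalities `psd^i(M) ≤ i - r` and `dim (R/p) ≤ d - r - 1` are written without
subtraction; an empty pseudo support has pseudo dimension `⊥`, and `⊥ + r = ⊥`. -/
theorem lemma4p4 (R : Type u) [CommRing R] [IsNoetherianRing R] [IsLocalRing R]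
    (M : Type u) [AddCommGroup M] [Module R M] [Module.Finite R M]
    (hM : PseudoSupport.IsEquidimensional R M)
    (hcat : PseudoSupport.IsCatenary (R ⧸ Module.annihilator R M)) (r : ℕ) :
    (PseudoSupport.SerreCondition R M r ↔
      ∀ i : ℕ, (i : WithBot ℕ∞) < Module.supportDim R M →
        PseudoSupport.psd R M i + (r : WithBot ℕ∞) ≤ (i : WithBot ℕ∞)) ∧
    (PseudoSupport.SerreCondition R M r →
      ∀ p ∈ PseudoSupport.nCM R M,
        ringKrullDim (R ⧸ p.asIdeal) + (r : WithBot ℕ∞) + 1 ≤ Module.supportDim R M) := by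
  exact ⟨PseudoSupport.serreCondition_iff_psd_le hM hcat r,
    fun hS _ hp ↦ PseudoSupport.ringKrullDim_add_le_of_mem_nCM hM hcat hS hp⟩
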